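/- Let $T>0$, $d>0$, $c\in(\tfrac12,1)$, $\epsilon\in(0,\tfrac12)$, let $\Phi$ be the standard normal distribution function, and let $w$ be a standard Brownian motion on a probability space with probability measure $\mu$. An open-loop attack signal is a (deterministic) Borel function $\theta:[0,T]\to\mathbb{R}$ with $\int_0^T|\theta(t)|\,dt<\infty$; it produces the trajectory $x$ with $dx(t)=\theta(t)\,dt+dw(t)$, $x(0)=0$, i.e. $x(t)=\int_0^t\theta(s)\,ds+w(t)$, $0\le t\le T$. A test is a (non-randomized, Borel measurable) map $\phi:C[0,T]\to\{0,1\}$. Let $\gamma(\theta)=\mu\{x(T)>Td\}=\Phi\big(\tfrac{1}{\sqrt T}\int_0^T\theta(t)\,dt-\sqrt T d\big)$ be the attack success rate, let $\alpha(\phi)$ be the false-alarm rate, i.e. the probability that $\phi(x)=1$ when $\theta=0$, and let $\beta(\theta,\phi)$ be the detection-failure rate, i.e. the probability that $\phi(x)=0$ under the attack signal $\theta$. In the zero-sum game the attacker chooses $\theta$ with $\gamma(\theta)\ge c$ to maximize $\beta(\theta,\phi)$, and the detector chooses $\phi$ with $\alpha(\phi)\le\epsilon$ to minimize it; a saddle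 point is a pair $(\theta_0,\phi_0)$ satisfying these constraints such that $\beta(\theta,\phi_0)\le\beta(\theta_0,\phi_0)\le\beta(\theta_0,\phi)$ for all $\theta$ with $\gamma(\theta)\ge c$ and all $\phi$ with $\alpha(\phi)\le\epsilon$. Put $$\theta^*(t)=\frac{\Phi^{-1}(c)}{\sqrt T}+d\quad(0\le t\le T),\qquad \phi^*(x)=\mathbf{1}\{x(T)>\sqrt T\,\Phi^{-1}(1-\epsilon)\}.$$ (i) $(\theta^*,\phi^*)$ is a saddle point. Consequently $$\min_{\phi:\,\alpha(\phi)\le\epsilon}\ \sup_{\theta:\,\gamma(\theta)\ge c}\beta(\theta,\phi)=\max_{\theta:\,\gamma(\theta)\ge c}\ \inf_{\phi:\,\alpha(\phi)\le\epsilon}\beta(\theta,\phi)=\beta(\theta^*,\phi^*),$$ where the outer minimum and the outer maximum are attained. (ii) The saddle point is unique: if $(\theta',\phi')$ is a saddle point, then $\theta'(t)=\theta^*(t)$ for almost every $t\in[0,T]$, and $\phi'(x)=\phi^*(x)$ holds $\mu$-almost surely, both for the trajectory $x$ under the attack $\theta^*$ and for the trajectory $x=w$ without attack. (iii) The value of the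 game is $$\beta(\theta^*,\phi^*)=\Phi\big(\Phi^{-1}(1-\epsilon)-\Phi^{-1}(c)-\sqrt T\,d\big).$$ In particular, if $1-\epsilon=c$, then $\beta(\theta^*,\phi^*)=\Phi(-\sqrt T\,d)$. -/

import Mathlib

open MeasureTheory ProbabilityTheory
open scoped NNReal

noncomputable section

namespace AttackGame

/-- The distribution function `Φ` of the standard normal law. -/
def stdNormalCDF (x : ℝ) : ℝ := cdf (gaussianReal 0 1) x

/-- The inverse `Φ⁻¹` of the standard normal distribution function. It is the two-sided inverse
of `Φ : ℝ → (0, 1)`; values outside `(0, 1)` are never used. -/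
def stdNormalInv (p : ℝ) : ℝ := sInf {x : ℝ | p ≤ stdNormalCDF x}

/-- `C[0,T]`, the space of continuous real-valued functions on `[0,T]`. -/
abbrev PathSpace (T : ℝ≥0) : Type := C(Set.Icc (0 : ℝ≥0) T, ℝ)

/-- `C[0,T]` carries the Borel `σ`-algebra of its (uniform) topology. -/
instance instMeasurableSpacePathSpace (T : ℝ≥0) : MeasurableSpace (PathSpace T) := borel _

instance instBorelSpacePathSpace (T : ℝ≥0) : BorelSpace (PathSpace T) := ⟨rfl⟩

/-- The terminal value `x(T)` of a path `x ∈ C[0,T]`. -/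
def terminal {T : ℝ≥0} (x : PathSpace T) : ℝ := x ⟨T, zero_le, le_rfl⟩

/-- Open-loop (deterministic) attack signals on `[0,T]`: Borel functions that are integrable on
`[0,T]`. Only the values on `[0,T]` matter. -/
structure IsSignal (T : ℝ≥0) (θ : ℝ → ℝ) : Prop where
  measurable : Measurable θ
  integrableOn : IntegrableOn θ (Set.Icc 0 (T : ℝ))

/-- Non-randomized tests `φ : C[0,T] → {0,1}`: `0` accepts "no attack", `1` raises an alarm. -/
def IsTest {T : ℝ≥0} (φ : PathSpace T → Fin 2) : Prop := Measurable φ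

section Model

variable {Ω : Type*}

/-- The solution `x(t) = ∫₀ᵗ θ(s) ds + w(t)` of `dx = θ dt + dw`, `x(0) = 0`. -/
def state (w : ℝ≥0 → Ω → ℝ) (θ : ℝ → ℝ) (t : ℝ≥0) (ω : Ω) : ℝ :=
  (∫ s in (0 : ℝ)..t, θ s) + w t ω

open Classical in
/-- The trajectory `x` on `[0,T]` as a random element of `C[0,T]`. (The paths of a Brownian motion
are continuous almost surely; on the exceptional null set the trajectory is set to `0`.) -/
def trajectory (T : ℝ≥0) (w : ℝ≥0 → Ω → ℝ) (θ : ℝ → ℝ) (ω : Ω) : PathSpace T :=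
  if h : Continuous (fun t : Set.Icc (0 : ℝ≥0) T => state w θ t ω) then ⟨_, h⟩ else 0

variable [MeasurableSpace Ω] (μ : Measure Ω)

/-- Attack success rate `γ(θ)`: the probability that the terminal state is unsafe, `x(T) > T d`. -/
def successRate (T : ℝ≥0) (w : ℝ≥0 → Ω → ℝ) (d : ℝ) (θ : ℝ → ℝ) : ℝ :=
  μ.real {ω | (T : ℝ) * d < state w θ T ω}

/-- False-alarm rate `α(φ)`: the probability of an alarm when there is no attack (`θ = 0`). -/
def falseAlarm {T : ℝ≥0} (w : ℝ≥0 → Ω → ℝ) (φ : PathSpace T → Fin 2) : ℝ :=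
  μ.real {ω | φ (trajectory T w 0 ω) = 1}

/-- Detection-failure rate `β(θ, φ)`: the probability of no alarm under the attack `θ`. -/
def detectionFailure {T : ℝ≥0} (w : ℝ≥0 → Ω → ℝ) (θ : ℝ → ℝ) (φ : PathSpace T → Fin 2) : ℝ :=
  μ.real {ω | φ (trajectory T w θ ω) = 0}

/-- The attacker's strategies: signals `θ` with `γ(θ) ≥ c`. -/
def attacks (T : ℝ≥0) (w : ℝ≥0 → Ω → ℝ) (d c : ℝ) : Set (ℝ → ℝ) :=
  {θ | IsSignal T θ ∧ c ≤ successRate μ T w d θ}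

/-- The detector's strategies: tests `φ` with `α(φ) ≤ ε`. -/
def tests (T : ℝ≥0) (w : ℝ≥0 → Ω → ℝ) (ε : ℝ) : Set (PathSpace T → Fin 2) :=
  {φ | IsTest φ ∧ falseAlarm μ w φ ≤ ε}

/-- Saddle points of the zero-sum game in which the attacker maximizes and the detector minimizes
`β(θ, φ)`. -/
def IsSaddlePoint (T : ℝ≥0) (w : ℝ≥0 → Ω → ℝ) (d c ε : ℝ)
    (θ₀ : ℝ → ℝ) (φ₀ : PathSpace T → Fin 2) : Prop :=
  θ₀ ∈ attacks μ T w d c ∧ φ₀ ∈ tests μ T w ε ∧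
    (∀ θ ∈ attacks μ T w d c, detectionFailure μ w θ φ₀ ≤ detectionFailure μ w θ₀ φ₀) ∧
    (∀ φ ∈ tests μ T w ε, detectionFailure μ w θ₀ φ₀ ≤ detectionFailure μ w θ₀ φ)

/-- `sup_θ β(θ, φ)` over the attacker's strategies (a supremum of numbers in `[0,1]`). -/
def worstCase (T : ℝ≥0) (w : ℝ≥0 → Ω → ℝ) (d c : ℝ) (φ : PathSpace T → Fin 2) : ℝ :=
  sSup ((fun θ => detectionFailure μ w θ φ) '' attacks μ T w d c)

/-- `inf_φ β(θ, φ)` over the detector's strategies (an infimum of numbers in `[0,1]`). -/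
def bestResponse (T : ℝ≥0) (w : ℝ≥0 → Ω → ℝ) (ε : ℝ) (θ : ℝ → ℝ) : ℝ :=
  sInf ((fun φ : PathSpace T → Fin 2 => detectionFailure μ w θ φ) '' tests μ T w ε)

end Model

/-- The constant bias injection attack `θ*(t) = Φ⁻¹(c) / √T + d`. -/
def biasAttack (T : ℝ≥0) (d c : ℝ) : ℝ → ℝ :=
  fun _ => stdNormalInv c / √(T : ℝ) + d

open Classical in
/-- The terminal-state threshold test `φ*(x) = 1{x(T) > √T Φ⁻¹(1 - ε)}`. -/
def thresholdTest (T : ℝ≥0) (ε : ℝ) : PathSpace T → Fin 2 :=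
  fun x => if √(T : ℝ) * stdNormalInv (1 - ε) < terminal x then 1 else 0

end AttackGame

end

/-! Under a signal `θ`, `x(T)` is Gaussian with mean `∫₀ᵀ θ` and variance `T`, so `γ(θ)` and `β(θ,
φ*)` see only the total drift. The constraint on `γ` is a lower bound on this drift and `β(θ, φ*)`
decreases in it; `θ*` attains the bound, hence is a best attack on `φ*`. Conversely, for a constant
drift `a > 0` the likelihood ratio is `exp (a x(T) - a² T / 2)`, increasing in `x(T)`, so
`neyman_pearson` makes `φ*` the best reply to `θ*`. This density
(`map_trajectory_const_eq_withDensity`) comes from splitting a path into its terminal value and an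
independent bridge that a constant drift leaves unchanged. For uniqueness, saddle points are
interchangeable. The equality case of Neyman–Pearson determines the test. A saddle attack has the
total drift of `θ*`, and `φ*` is optimal against it; comparing `φ*` with tests on combinations of
`x(T)` and `x(t)` forces the primitive of the attack to be linear
(`integral_eq_of_thresholdTest_optimal`). These competitors involve only Gaussian variables, so no
density formula for a general drift is needed. -/

namespace AttackGame

/-! ### The normal distribution function and Gaussian tails. -/

lemma strictMono_stdNormalCDF : StrictMono stdNormalCDF := by
  intro x y hxy
  simp only [stdNormalCDF, cdf_eq_real]
  have h : Set.Iic y = Set.Iic x ∪ Set.Ioc x y := (Set.Iic_union_Ioc_eq_Iic hxy.le).symm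
  rw [h, measureReal_union (Set.Iic_disjoint_Ioc le_rfl) measurableSet_Ioc]
  have : 0 < (gaussianReal 0 1).real (Set.Ioc x y) := by
    refine ENNReal.toReal_pos (fun h0 => ?_) (measure_ne_top _ _)
    have := gaussianReal_absolutelyContinuous' 0 one_ne_zero h0
    simp [hxy.not_ge] at this
  linarith

lemma continuous_stdNormalCDF : Continuous stdNormalCDF := by
  have : NullSingletonClass (gaussianReal 0 1) := nullSingletonClass_gaussianReal one_ne_zero
  rw [continuous_iff_continuousAt]
  intro x
  have h := (cdf (gaussianReal 0 1)).measure_singleton x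
  rw [measure_cdf, measure_singleton, eq_comm, ENNReal.ofReal_eq_zero] at h
  have hl : Function.leftLim (cdf (gaussianReal 0 1)) x = cdf (gaussianReal 0 1) x :=
    le_antisymm ((monotone_cdf _).leftLim_le le_rfl) (by linarith)
  exact (monotone_cdf (gaussianReal 0 1)).continuousAt_iff_leftLim_eq_rightLim.2
    (by rw [hl, (cdf (gaussianReal 0 1)).rightLim_eq])

lemma stdNormalCDF_stdNormalInv {p : ℝ} (h0 : 0 < p) (h1 : p < 1) :
    stdNormalCDF (stdNormalInv p) = p := by
  obtain ⟨x, hx⟩ : ∃ x, stdNormalCDF x = p := by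
    have ha := ((tendsto_cdf_atBot (gaussianReal 0 1)).eventually (gt_mem_nhds h0)).exists
    have hb := ((tendsto_cdf_atTop (gaussianReal 0 1)).eventually (lt_mem_nhds h1)).exists
    obtain ⟨⟨a, ha⟩, b, hb⟩ := And.intro ha hb
    exact mem_range_of_exists_le_of_exists_ge continuous_stdNormalCDF ⟨a, ha.le⟩ ⟨b, hb.le⟩
  have : {y | p ≤ stdNormalCDF y} = Set.Ici x := by
    ext y
    simp [← hx, strictMono_stdNormalCDF.le_iff_le]
  rw [stdNormalInv, this, csInf_Ici, hx]

lemma stdNormalCDF_neg (x : ℝ) : stdNormalCDF (-x) = 1 - stdNormalCDF x := by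
  have : NullSingletonClass (gaussianReal 0 1) := nullSingletonClass_gaussianReal one_ne_zero
  have h : (gaussianReal 0 1).map (fun y => -y) = gaussianReal 0 1 := by
    simp [gaussianReal_map_neg]
  simp only [stdNormalCDF, cdf_eq_real]
  rw [← probReal_compl_eq_one_sub measurableSet_Iic]
  nth_rw 1 [← h]
  rw [map_measureReal_apply measurable_neg measurableSet_Iic, Set.compl_Iic]
  have : (fun y : ℝ => -y) ⁻¹' Set.Iic (-x) = Set.Ici x := by ext; simp
  rw [this, measureReal_def, measureReal_def, measure_congr Ioi_ae_eq_Ici]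

section

variable {Ω : Type*} [MeasurableSpace Ω] {μ : Measure Ω} {w : ℝ≥0 → Ω → ℝ} {T : ℝ≥0} {θ : ℝ → ℝ}

lemma measureReal_le_of_hasLaw_gaussianReal {X : Ω → ℝ} {m : ℝ} {v : ℝ≥0} (hv : v ≠ 0)
    (hX : HasLaw X (gaussianReal m v) μ) (k : ℝ) :
    μ.real {ω | X ω ≤ k} = stdNormalCDF ((k - m) / √(v : ℝ)) := by
  have hs : 0 < √(v : ℝ) := Real.sqrt_pos.2 (by positivity)
  have hZ := gaussianReal_div_const (gaussianReal_sub_const hX m) √(v : ℝ)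
  have hZ' : HasLaw (fun ω => (X ω - m) / √(v : ℝ)) (gaussianReal 0 1) μ := by
    convert hZ using 2
    · simp
    · ext
      simp [Real.sq_sqrt, hv]
  rw [stdNormalCDF, cdf_eq_real, ← hZ'.map_eq, measureReal_def, measureReal_def,
    Measure.map_apply_of_aemeasurable hZ'.aemeasurable measurableSet_Iic]
  congr 2
  ext ω
  simp [div_le_div_iff_of_pos_right hs]

lemma measureReal_lt_of_hasLaw_gaussianReal [IsProbabilityMeasure μ] {X : Ω → ℝ} {m : ℝ} {v : ℝ≥0}
    (hv : v ≠ 0) (hX : HasLaw X (gaussianReal m v) μ) (k : ℝ) :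
    μ.real {ω | k < X ω} = stdNormalCDF ((m - k) / √(v : ℝ)) := by
  have h := measureReal_le_of_hasLaw_gaussianReal hv hX k
  have hm : NullMeasurableSet {ω | X ω ≤ k} μ :=
    hX.aemeasurable.nullMeasurable measurableSet_Iic
  have hc : {ω | k < X ω} = {ω | X ω ≤ k}ᶜ := by ext; simp
  rw [hc, probReal_compl_eq_one_sub₀ hm, h, ← stdNormalCDF_neg]
  ring_nf

/-! ### Path space and measurability of the trajectory. -/

/-- By continuity a closed ball is cut out by conditions at countably many dense times, and by
separability an open set is a countable union of closed balls. Measurability and independence can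
thus be checked on evaluations. -/
lemma measurableSpace_pathSpace_eq_comap (T : ℝ≥0) :
    instMeasurableSpacePathSpace T =
      MeasurableSpace.comap (fun (x : PathSpace T) t => x t) MeasurableSpace.pi := by
  have : Nonempty (Set.Icc (0 : ℝ≥0) T) := ⟨⟨T, zero_le, le_rfl⟩⟩
  have heval : Measurable fun (x : PathSpace T) t => x t :=
    measurable_pi_lambda _ fun t => (continuous_eval_const t).measurable
  set m := MeasurableSpace.comap (fun (x : PathSpace T) t => x t) MeasurableSpace.pi with hm
  apply le_antisymm
  · have hev : ∀ t, Measurable[m] (fun x : PathSpace T => x t) := fun t =>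
      (measurable_pi_apply t).comp (comap_measurable _)
    have hball : ∀ (c : PathSpace T) (r : ℝ), MeasurableSet[m] (Metric.closedBall c r) := by
      intro c r
      rcases lt_or_ge r 0 with hr | hr
      · rw [Metric.closedBall_eq_empty.2 hr]
        exact @MeasurableSet.empty _ m
      have : Metric.closedBall c r =
          ⋂ n : ℕ, {x : PathSpace T | dist (x (TopologicalSpace.denseSeq _ n))
            (c (TopologicalSpace.denseSeq _ n)) ≤ r} := by
        ext x
        simp only [Metric.mem_closedBall, ContinuousMap.dist_le hr, Set.mem_iInter,
          Set.mem_ofPred_eq]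
        refine ⟨fun h n => h _, fun h t => ?_⟩
        have hcl : IsClosed {t | dist (x t) (c t) ≤ r} :=
          isClosed_le (by fun_prop) continuous_const
        exact hcl.closure_subset_iff.2 (by rintro _ ⟨n, rfl⟩; exact h n)
          ((TopologicalSpace.denseRange_denseSeq (Set.Icc (0 : ℝ≥0) T)) t)
      rw [this]
      refine @MeasurableSet.iInter _ _ m _ _ fun n => ?_
      exact ((hev _).dist measurable_const) measurableSet_Iic
    change borel _ ≤ m
    refine MeasurableSpace.generateFrom_le fun s hs => ?_
    replace hs : IsOpen s := hs
    obtain ⟨D, hDc, hD⟩ := TopologicalSpace.exists_countable_dense (PathSpace T)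
    have hU : s = ⋃ c ∈ D, ⋃ q ∈ {q : ℚ | Metric.closedBall c (q : ℝ) ⊆ s},
        Metric.closedBall c (q : ℝ) := by
      ext x
      simp only [Set.mem_iUnion, Set.mem_ofPred_eq, exists_prop]
      refine ⟨fun hx => ?_, fun ⟨c, _, q, hq, hxq⟩ => hq hxq⟩
      obtain ⟨δ, hδ, hs'⟩ := Metric.isOpen_iff.1 hs x hx
      obtain ⟨c, hcD, hc⟩ := hD.exists_dist_lt x (by positivity : 0 < δ / 3)
      obtain ⟨q, hq1, hq2⟩ := exists_rat_btwn (by linarith : δ / 3 < δ / 2)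
      refine ⟨c, hcD, q, fun y hy => hs' ?_, ?_⟩
      · rw [Metric.mem_closedBall] at hy
        rw [Metric.mem_ball]
        linarith [dist_triangle y c x, dist_comm c x]
      · rw [Metric.mem_closedBall]
        linarith
    rw [hU]
    exact @MeasurableSet.biUnion _ _ m _ _ hDc fun c _ =>
      @MeasurableSet.biUnion _ _ m _ _ (Set.to_countable _) fun q _ => hball c q
  · exact heval.comap_le

/-- The exceptional null sets of uncountably many times cannot be united. Passing to the completed
σ-algebra makes every coordinate measurable outright, and a null-measurable map into `C[0,T]` is
then a.e. measurable. -/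
lemma aemeasurable_pathSpace {T : ℝ≥0} {X : Ω → PathSpace T}
    (h : ∀ t, AEMeasurable (fun ω => X ω t) μ) : AEMeasurable X μ := by
  have hp : @Measurable (NullMeasurableSpace Ω μ) (Set.Icc (0 : ℝ≥0) T → ℝ) _ _
      (fun ω t => X ω t) :=
    measurable_pi_iff.2 fun t => (h t).nullMeasurable.measurable'
  have hm : NullMeasurable X μ := by
    intro s hs
    rw [measurableSpace_pathSpace_eq_comap] at hs
    obtain ⟨u, hu, rfl⟩ := hs
    exact hp hu
  exact hm.aemeasurable

lemma continuous_primitive_nnreal {T : ℝ≥0} {θ : ℝ → ℝ} (hθ : IntegrableOn θ (Set.Icc 0 (T : ℝ))) :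
    Continuous fun t : Set.Icc (0 : ℝ≥0) T => ∫ s in (0 : ℝ)..(t : ℝ≥0), θ s := by
  have h := intervalIntegral.continuousOn_primitive_interval
    (μ := volume) (f := θ) (a := 0) (b := T) (by rwa [Set.uIcc_of_le T.coe_nonneg])
  rw [Set.uIcc_of_le T.coe_nonneg] at h
  exact h.comp_continuous (f := fun t : Set.Icc (0 : ℝ≥0) T => ((t : ℝ≥0) : ℝ))
    (by fun_prop) fun t => ⟨t.1.2, by exact_mod_cast t.2.2⟩

lemma trajectory_ae_eq (hw : IsBrownianReal w μ) (hθ : IntegrableOn θ (Set.Icc 0 (T : ℝ))) :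
    ∀ᵐ ω ∂μ, ∀ t : Set.Icc (0 : ℝ≥0) T, trajectory T w θ ω t = state w θ t ω := by
  filter_upwards [hw.cont] with ω hω t
  have h : Continuous (fun t : Set.Icc (0 : ℝ≥0) T => state w θ t ω) :=
    (continuous_primitive_nnreal hθ).add (hω.comp continuous_subtype_val)
  simp [trajectory, h]

lemma aemeasurable_trajectory (hw : IsBrownianReal w μ)
    (hθ : IntegrableOn θ (Set.Icc 0 (T : ℝ))) : AEMeasurable (trajectory T w θ) μ := by
  refine aemeasurable_pathSpace fun t => ?_
  have : AEMeasurable (state w θ t) μ := (hw.aemeasurable t).const_add _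
  refine this.congr ?_
  filter_upwards [trajectory_ae_eq hw hθ] with ω hω using (hω t).symm

/-! ### Threshold tests on linear statistics, and their error rates. -/

lemma hasLaw_linearCombination_brownian [IsProbabilityMeasure μ] (hw : IsBrownianReal w μ)
    {s t : ℝ≥0} (hst : s ≤ t) (a b : ℝ) :
    HasLaw (fun ω => a * w t ω + b * w s ω)
      (gaussianReal 0 (a ^ 2 * t + 2 * (a * b * s) + b ^ 2 * s).toNNReal) μ := by
  have hG := hw.isGaussianProcess
  have ht := (hG.hasGaussianLaw_eval t).memLp_two
  have hs := (hG.hasGaussianLaw_eval s).memLp_two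
  have h : HasGaussianLaw (fun ω => a * w t ω + b * w s ω) μ := by
    simpa using (hG.hasGaussianLaw_prodMk (s := t) (t := s)).map_fun
      (a • ContinuousLinearMap.fst ℝ ℝ ℝ + b • ContinuousLinearMap.snd ℝ ℝ ℝ)
  refine ⟨h.aemeasurable, ?_⟩
  rw [h.map_eq_gaussianReal]
  congr 2
  · rw [integral_add ((hw.integrable_eval t).const_mul a) ((hw.integrable_eval s).const_mul b),
      integral_const_mul, integral_const_mul, hw.integral_eval, hw.integral_eval]
    simp
  · rw [variance_fun_add (ht.const_mul a) (hs.const_mul b), variance_const_mul, variance_const_mul,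
      covariance_const_mul_left, covariance_const_mul_right, hw.covariance_fun_eval,
      ← covariance_self (hw.aemeasurable t), ← covariance_self (hw.aemeasurable s),
      hw.covariance_eval, hw.covariance_eval, min_eq_right hst, min_self, min_self]
    ring

/-- The linear functional `x ↦ a x(T) + b x(t)` on path space. -/
noncomputable def twoPoint (a b : ℝ) (t : Set.Icc (0 : ℝ≥0) T) (x : PathSpace T) : ℝ :=
  a * terminal x + b * x t

open Classical in
/-- The test that raises an alarm when the statistic `ℓ` exceeds `k`. -/
noncomputable def statisticTest (ℓ : PathSpace T → ℝ) (k : ℝ) : PathSpace T → Fin 2 :=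
  fun x => if k < ℓ x then 1 else 0

lemma continuous_terminal : Continuous (terminal : PathSpace T → ℝ) := continuous_eval_const _

lemma continuous_twoPoint (a b : ℝ) (t : Set.Icc (0 : ℝ≥0) T) : Continuous (twoPoint a b t) :=
  (continuous_terminal.const_mul a).add ((continuous_eval_const t).const_mul b)

lemma isTest_statisticTest {ℓ : PathSpace T → ℝ} (hℓ : Continuous ℓ) (k : ℝ) :
    IsTest (statisticTest ℓ k) :=
  Measurable.ite (measurableSet_lt measurable_const hℓ.measurable) measurable_const measurable_const

lemma thresholdTest_eq_statisticTest (ε : ℝ) :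
    thresholdTest T ε = statisticTest terminal (√(T : ℝ) * stdNormalInv (1 - ε)) := rfl

lemma detectionFailure_statisticTest {ℓ : PathSpace T → ℝ} {m : ℝ} {v : ℝ≥0} (hv : v ≠ 0)
    (h : HasLaw (fun ω => ℓ (trajectory T w θ ω)) (gaussianReal m v) μ) (k : ℝ) :
    detectionFailure μ w θ (statisticTest ℓ k) = stdNormalCDF ((k - m) / √(v : ℝ)) := by
  rw [← measureReal_le_of_hasLaw_gaussianReal hv h]
  simp [detectionFailure, statisticTest]

lemma falseAlarm_statisticTest [IsProbabilityMeasure μ] {ℓ : PathSpace T → ℝ} {v : ℝ≥0}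
    (hv : v ≠ 0)
    (h : HasLaw (fun ω => ℓ (trajectory T w 0 ω)) (gaussianReal 0 v) μ) (q : ℝ) :
    falseAlarm μ w (statisticTest ℓ (√(v : ℝ) * q)) = 1 - stdNormalCDF q := by
  have hs : 0 < √(v : ℝ) := Real.sqrt_pos.2 (by positivity)
  have := measureReal_lt_of_hasLaw_gaussianReal hv h (√(v : ℝ) * q)
  rw [← stdNormalCDF_neg, show -q = (0 - √(v : ℝ) * q) / √(v : ℝ) by field_simp; ring, ← this]
  simp [falseAlarm, statisticTest]

lemma hasLaw_twoPoint_trajectory [IsProbabilityMeasure μ] (hw : IsBrownianReal w μ)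
    (hθ : IntegrableOn θ (Set.Icc 0 (T : ℝ))) (a b : ℝ) (t : Set.Icc (0 : ℝ≥0) T) :
    HasLaw (fun ω => twoPoint a b t (trajectory T w θ ω))
      (gaussianReal (a * (∫ s in (0 : ℝ)..T, θ s) + b * ∫ s in (0 : ℝ)..t, θ s)
        (a ^ 2 * T + 2 * (a * b * t) + b ^ 2 * t).toNNReal) μ := by
  have h := gaussianReal_const_add (hasLaw_linearCombination_brownian hw t.2.2 a b)
    (a * (∫ s in (0 : ℝ)..T, θ s) + b * ∫ s in (0 : ℝ)..t, θ s)
  rw [zero_add] at h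
  refine h.congr ?_
  filter_upwards [trajectory_ae_eq hw hθ] with ω hω
  simp only [twoPoint, terminal, hω, state]
  ring

lemma hasLaw_terminal_trajectory [IsProbabilityMeasure μ] (hw : IsBrownianReal w μ)
    (hθ : IntegrableOn θ (Set.Icc 0 (T : ℝ))) :
    HasLaw (fun ω => terminal (trajectory T w θ ω))
      (gaussianReal (∫ s in (0 : ℝ)..T, θ s) T) μ := by
  simpa [twoPoint] using hasLaw_twoPoint_trajectory hw hθ 1 0 ⟨T, zero_le, le_rfl⟩

lemma successRate_eq [IsProbabilityMeasure μ] (hw : IsBrownianReal w μ) (hT : T ≠ 0) (d : ℝ) :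
    successRate μ T w d θ = stdNormalCDF (((∫ s in (0 : ℝ)..T, θ s) - T * d) / √(T : ℝ)) := by
  have h := gaussianReal_const_add (hw.hasLaw_eval T) (∫ s in (0 : ℝ)..T, θ s)
  rw [zero_add] at h
  exact measureReal_lt_of_hasLaw_gaussianReal hT h _

lemma le_successRate_iff [IsProbabilityMeasure μ] (hw : IsBrownianReal w μ) (hT : 0 < T)
    {d c : ℝ} (hc0 : 0 < c) (hc1 : c < 1) :
    c ≤ successRate μ T w d θ ↔
      (T : ℝ) * (stdNormalInv c / √(T : ℝ) + d) ≤ ∫ s in (0 : ℝ)..T, θ s := by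
  have hs : 0 < √(T : ℝ) := Real.sqrt_pos.2 hT
  have hss : √(T : ℝ) * √(T : ℝ) = T := Real.mul_self_sqrt T.coe_nonneg
  rw [successRate_eq hw hT.ne', ← stdNormalCDF_stdNormalInv hc0 hc1,
    strictMono_stdNormalCDF.le_iff_le, stdNormalCDF_stdNormalInv hc0 hc1, le_div_iff₀ hs,
    le_sub_iff_add_le]
  have : (T : ℝ) * (stdNormalInv c / √(T : ℝ) + d) = stdNormalInv c * √(T : ℝ) + T * d := by
    nth_rw 1 [← hss]
    field_simp
    linear_combination d * hss
  rw [this]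

lemma detectionFailure_thresholdTest [IsProbabilityMeasure μ] (hw : IsBrownianReal w μ)
    (hT : 0 < T) (hθ : IntegrableOn θ (Set.Icc 0 (T : ℝ))) (ε : ℝ) :
    detectionFailure μ w θ (thresholdTest T ε) =
      stdNormalCDF (stdNormalInv (1 - ε) - (∫ s in (0 : ℝ)..T, θ s) / √(T : ℝ)) := by
  have hs : 0 < √(T : ℝ) := Real.sqrt_pos.2 hT
  rw [thresholdTest_eq_statisticTest,
    detectionFailure_statisticTest hT.ne' (hasLaw_terminal_trajectory hw hθ)]
  congr 1
  field_simp

lemma statisticTest_mem_tests [IsProbabilityMeasure μ] {ℓ : PathSpace T → ℝ} {v : ℝ≥0}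
    {ε : ℝ} (hv : v ≠ 0) (hℓ : Continuous ℓ)
    (h : HasLaw (fun ω => ℓ (trajectory T w 0 ω)) (gaussianReal 0 v) μ)
    (hε0 : 0 < ε) (hε1 : ε < 1) :
    statisticTest ℓ (√(v : ℝ) * stdNormalInv (1 - ε)) ∈ tests μ T w ε := by
  refine ⟨isTest_statisticTest hℓ _, ?_⟩
  rw [falseAlarm_statisticTest hv h, stdNormalCDF_stdNormalInv (by linarith) (by linarith)]
  linarith

lemma thresholdTest_mem_tests [IsProbabilityMeasure μ] (hw : IsBrownianReal w μ) (hT : 0 < T)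
    {ε : ℝ} (hε0 : 0 < ε) (hε1 : ε < 1) : thresholdTest T ε ∈ tests μ T w ε := by
  have h := hasLaw_terminal_trajectory (T := T) (θ := 0) hw integrableOn_zero
  simp only [Pi.zero_apply, intervalIntegral.integral_zero] at h
  exact statisticTest_mem_tests hT.ne' continuous_terminal h hε0 hε1

/-! ### Uniqueness of the attack: the primitive is linear. -/

/-- If the terminal test is optimal against a signal with positive total drift, then the drift is
spread uniformly over time. -/
lemma integral_eq_of_thresholdTest_optimal [IsProbabilityMeasure μ] (hw : IsBrownianReal w μ)
    (hT : 0 < T) (hθ : IntegrableOn θ (Set.Icc 0 (T : ℝ))) {ε : ℝ} (hε0 : 0 < ε) (hε1 : ε < 1)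
    (hpos : 0 < ∫ s in (0 : ℝ)..T, θ s)
    (hopt : ∀ φ ∈ tests μ T w ε,
      detectionFailure μ w θ (thresholdTest T ε) ≤ detectionFailure μ w θ φ)
    (t : Set.Icc (0 : ℝ≥0) T) :
    ∫ s in (0 : ℝ)..t, θ s = t / T * ∫ s in (0 : ℝ)..T, θ s := by
  set m := ∫ s in (0 : ℝ)..T, θ s with hm
  set h := (∫ s in (0 : ℝ)..t, θ s) - t / T * m with hh
  have hT' : (0 : ℝ) < T := hT
  -- The variance of the bridge value `w(t) - (t/T) w(T)`; `h` is its mean under the attack.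
  set u : ℝ := t - t ^ 2 / T with hu
  have hu0 : 0 ≤ u := by
    have h1 : (t : ℝ) ≤ T := by exact_mod_cast t.2.2
    have h2 : (0 : ℝ) ≤ t := t.1.2
    rw [hu, sub_nonneg, div_le_iff₀ hT']
    nlinarith
  -- The competitor thresholds `x(T) + s (x(t) - (t/T) x(T))`. The two summands are uncorrelated, so
  -- the variance is `T + s² u`, while the mean is `m + s h`. At equal size, failure rates are
  -- ordered by the ratio of mean to standard deviation.
  have key : ∀ s : ℝ, (m + s * h) / √(T + s ^ 2 * u) ≤ m / √(T : ℝ) := by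
    intro s
    have hv : (1 - s * (t / T) : ℝ) ^ 2 * T + 2 * ((1 - s * (t / T)) * s * t) + s ^ 2 * t
        = T + s ^ 2 * u := by
      rw [hu]
      field_simp
      ring
    have hvpos : 0 < T + s ^ 2 * u := by positivity
    have hv0 : (T + s ^ 2 * u).toNNReal ≠ 0 := by simpa using hvpos
    have hvc : (((T + s ^ 2 * u).toNNReal : ℝ≥0) : ℝ) = T + s ^ 2 * u :=
      Real.coe_toNNReal _ hvpos.le
    have hs : 0 < √(T + s ^ 2 * u) := Real.sqrt_pos.2 hvpos
    have h0 := hasLaw_twoPoint_trajectory (T := T) (θ := 0) hw integrableOn_zero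
      (1 - s * (t / T)) s t
    simp only [Pi.zero_apply, intervalIntegral.integral_zero, mul_zero, add_zero, hv] at h0
    have h1 := hasLaw_twoPoint_trajectory hw hθ (1 - s * (t / T)) s t
    rw [hv] at h1
    have h2 := hopt _ (statisticTest_mem_tests hv0 (continuous_twoPoint _ s t) h0 hε0 hε1)
    rw [detectionFailure_statisticTest hv0 h1, detectionFailure_thresholdTest hw hT hθ,
      strictMono_stdNormalCDF.le_iff_le, hvc, sub_div, mul_div_cancel_left₀ _ hs.ne'] at h2
    have h3 : (1 - s * (t / T)) * m + s * (∫ s in (0 : ℝ)..t, θ s) = m + s * h := by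
      rw [hh]
      ring
    rw [h3] at h2
    linarith
  suffices h = 0 by linarith
  by_contra hne
  -- Take `s = δ h`: the mean gains `δ h²` at first order and the variance only at second order.
  -- After squaring and dividing by `δ h² m`, `key` gives `2 T ≤ δ m u`, whereas this `δ` makes `δ m
  -- u < T`.
  have hd : 0 < T / (m * (u + 1)) := by positivity
  set δ := T / (m * (u + 1)) with hδ
  have hk := key (δ * h)
  have hv : 0 < T + (δ * h) ^ 2 * u := by positivity
  rw [div_le_div_iff₀ (Real.sqrt_pos.2 hv) (Real.sqrt_pos.2 hT')] at hk
  have hnn : 0 ≤ m + δ * h * h := by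
    rw [mul_assoc]
    exact add_nonneg hpos.le (mul_nonneg hd.le (mul_self_nonneg h))
  have hsq := pow_le_pow_left₀ (mul_nonneg hnn (Real.sqrt_nonneg _)) hk 2
  rw [mul_pow, mul_pow, Real.sq_sqrt hT'.le, Real.sq_sqrt hv.le] at hsq
  have hδ' : δ * (m * (u + 1)) = T := div_mul_cancel₀ _ (by positivity)
  have hh2 : 0 < δ * h ^ 2 * m := by positivity
  have : δ * h ^ 2 * m * (2 * T) ≤ δ * h ^ 2 * m * (δ * m * u) := by
    nlinarith [show 0 ≤ (δ * h * h) ^ 2 * T by positivity]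
  have h4 := le_of_mul_le_mul_left this hh2
  nlinarith [mul_pos hd hpos]

/-- Lebesgue differentiation. The endpoints are discarded because the identity must hold on a
neighbourhood of the point. -/
lemma ae_eq_const_of_integral_eq {a : ℝ} (hθ : IntegrableOn θ (Set.Icc 0 (T : ℝ)))
    (h : ∀ t : Set.Icc (0 : ℝ≥0) T, ∫ s in (0 : ℝ)..t, θ s = a * t) :
    ∀ᵐ t ∂(volume.restrict (Set.Icc 0 (T : ℝ))), θ t = a := by
  have hi : IntervalIntegrable θ volume 0 T :=
    (intervalIntegrable_iff_integrableOn_Icc_of_le T.coe_nonneg).2 hθ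
  rw [ae_restrict_iff' measurableSet_Icc]
  have h0 : ∀ᵐ x : ℝ, x ≠ 0 := by simp [ae_iff, measure_singleton]
  have h1 : ∀ᵐ x : ℝ, x ≠ T := by simp [ae_iff, measure_singleton]
  filter_upwards [hi.ae_hasDerivAt_integral, h0, h1] with x hx hx0 hx1 hxm
  rw [Set.uIcc_of_le T.coe_nonneg] at hx
  have hd := hx hxm 0 ⟨le_rfl, T.coe_nonneg⟩
  have hd' : HasDerivAt (fun x : ℝ => a * x) a x := by simpa using (hasDerivAt_id x).const_mul a
  refine hd.unique (hd'.congr_of_eventuallyEq ?_)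
  filter_upwards [Ioo_mem_nhds (lt_of_le_of_ne hxm.1 hx0.symm) (lt_of_le_of_ne hxm.2 hx1)] with y hy
  exact h ⟨⟨y, hy.1.le⟩, zero_le, hy.2.le⟩

/-! ### Likelihood ratios and the Neyman–Pearson lemma. -/

lemma gaussianReal_eq_withDensity (m : ℝ) {v : ℝ≥0} (hv : v ≠ 0) :
    gaussianReal m v = (gaussianReal 0 v).withDensity
      (fun x => ENNReal.ofReal (Real.exp ((m * x - m ^ 2 / 2) / v))) := by
  rw [gaussianReal_of_var_ne_zero _ hv, gaussianReal_of_var_ne_zero _ hv,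
    ← withDensity_mul _ (by fun_prop) (by fun_prop)]
  congr 1
  ext x
  have hv' : (v : ℝ) ≠ 0 := by exact_mod_cast hv
  simp only [Pi.mul_apply, gaussianPDF, gaussianPDFReal]
  rw [← ENNReal.ofReal_mul (by positivity), mul_assoc _ _ (Real.exp _),
    ← Real.exp_add]
  congr 3
  field_simp
  ring

lemma map_withDensity_comp {α β : Type*} [MeasurableSpace α] [MeasurableSpace β] (ν : Measure α)
    {f : α → β} (hf : Measurable f) {g : β → ENNReal} (hg : Measurable g) :
    (ν.withDensity (g ∘ f)).map f = (ν.map f).withDensity g := by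
  ext s hs
  rw [Measure.map_apply hf hs, withDensity_apply _ (hf hs), withDensity_apply _ hs,
    setLIntegral_map hs hg hf]
  rfl

/-- **Neyman–Pearson lemma**, with the uniqueness of the most powerful test. -/
lemma neyman_pearson {α : Type*} [MeasurableSpace α] {ν : Measure α} [IsFiniteMeasure ν]
    {g : α → ℝ} (hg0 : ∀ x, 0 ≤ g x) (hg : Integrable g ν) {l : ℝ} (hl : 0 ≤ l)
    {A R : Set α} (hA : MeasurableSet A) (hR : MeasurableSet R) (hAg : ∀ x, x ∈ A ↔ l < g x)
    (hsize : ν.real R ≤ ν.real A) :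
    (ν.withDensity fun x => ENNReal.ofReal (g x)).real R ≤
      (ν.withDensity fun x => ENNReal.ofReal (g x)).real A ∧
    ((ν.withDensity fun x => ENNReal.ofReal (g x)).real A ≤
      (ν.withDensity fun x => ENNReal.ofReal (g x)).real R → (∀ᵐ x ∂ν, g x ≠ l) →
        ∀ᵐ x ∂ν, x ∈ R ↔ x ∈ A) := by
  have hset : ∀ {B : Set α}, MeasurableSet B →
      (ν.withDensity fun x => ENNReal.ofReal (g x)).real B = ∫ x in B, g x ∂ν := by
    intro B hB
    rw [measureReal_def, withDensity_apply _ hB, integral_eq_lintegral_of_nonneg_ae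
      (Filter.Eventually.of_forall hg0) hg.aestronglyMeasurable.restrict]
  rw [hset hA, hset hR]
  have hgl : Integrable (fun x => g x - l) ν := hg.sub (integrable_const l)
  -- Here `f = (1_A - 1_R)(g - l)` is nonnegative because `A = {g > l}`. Its integral is the gain in
  -- power minus `l` times the gain in size. Equal power forces `f = 0` a.e., so `A` and `R` agree
  -- a.e. off `{g = l}`.
  set f : α → ℝ := fun x => A.indicator (fun x => g x - l) x - R.indicator (fun x => g x - l) x
    with hf
  have hfi : Integrable f ν := (hgl.indicator hA).sub (hgl.indicator hR)
  have hf0 : ∀ x, 0 ≤ f x := by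
    intro x
    simp only [hf, Set.indicator]
    have := hAg x
    grind
  have hint : ∫ x, f x ∂ν = (∫ x in A, g x ∂ν) - (∫ x in R, g x ∂ν)
      - l * (ν.real A - ν.real R) := by
    rw [hf, integral_sub (hgl.indicator hA) (hgl.indicator hR), integral_indicator hA,
      integral_indicator hR, integral_sub hg.integrableOn (integrable_const l),
      integral_sub hg.integrableOn (integrable_const l)]
    simp
    ring
  have hnn : 0 ≤ l * (ν.real A - ν.real R) := mul_nonneg hl (sub_nonneg.2 hsize)
  refine ⟨by linarith [integral_nonneg (μ := ν) (f := f) hf0], fun hle hne => ?_⟩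
  have hz : ∫ x, f x ∂ν = 0 :=
    le_antisymm (by linarith) (integral_nonneg hf0)
  rw [integral_eq_zero_iff_of_nonneg hf0 hfi] at hz
  filter_upwards [hz, hne] with x hx hxl
  simp only [hf, Set.indicator, Pi.zero_apply] at hx
  grind

/-! ### Bridge decomposition and the density of a constant drift. -/

/-- The path `x` sheared linearly in time so that its terminal value becomes `r`. -/
noncomputable def pinned (p : ℝ × PathSpace T) : PathSpace T :=
  p.2 + ((p.1 - terminal p.2) / T) • ⟨fun t => ((t : ℝ≥0) : ℝ), by fun_prop⟩

lemma pinned_apply (p : ℝ × PathSpace T) (t : Set.Icc (0 : ℝ≥0) T) :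
    pinned p t = p.2 t + (p.1 - terminal p.2) / T * t := rfl

lemma terminal_pinned (hT : T ≠ 0) (p : ℝ × PathSpace T) : terminal (pinned p) = p.1 := by
  have : (T : ℝ) ≠ 0 := by exact_mod_cast hT
  change p.2 _ + (p.1 - terminal p.2) / T * T = p.1
  rw [div_mul_cancel₀ _ this]
  simp [terminal]

lemma measurable_pinned : Measurable (pinned : ℝ × PathSpace T → PathSpace T) := by
  have h : Continuous (terminal : PathSpace T → ℝ) := continuous_terminal
  have : Continuous (pinned : ℝ × PathSpace T → PathSpace T) := by
    unfold pinned
    fun_prop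
  exact this.measurable

/-- The bridge from `0` to `0` obtained from the driving noise. -/
noncomputable def bridge (T : ℝ≥0) (w : ℝ≥0 → Ω → ℝ) (ω : Ω) : PathSpace T :=
  pinned (0, trajectory T w 0 ω)

lemma aemeasurable_bridge (hw : IsBrownianReal w μ) : AEMeasurable (bridge T w) μ :=
  measurable_pinned.comp_aemeasurable
    (aemeasurable_const.prodMk (aemeasurable_trajectory hw integrableOn_zero))

lemma bridge_ae_eq (hw : IsBrownianReal w μ) : ∀ᵐ ω ∂μ, ∀ t : Set.Icc (0 : ℝ≥0) T,
    bridge T w ω t = w t ω + (-(t / T) : ℝ) * w T ω := by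
  filter_upwards [trajectory_ae_eq (T := T) (θ := 0) hw integrableOn_zero] with ω hω t
  simp only [bridge, pinned_apply, terminal, hω, state, Pi.zero_apply,
    intervalIntegral.integral_zero]
  ring

lemma trajectory_const_ae_eq (hw : IsBrownianReal w μ) (hT : T ≠ 0) (a : ℝ) :
    ∀ᵐ ω ∂μ, trajectory T w (fun _ => a) ω = pinned (a * T + w T ω, bridge T w ω) := by
  have hT' : (T : ℝ) ≠ 0 := by exact_mod_cast hT
  filter_upwards [bridge_ae_eq (T := T) hw, trajectory_ae_eq (T := T) (θ := fun _ => a) hw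
    (integrableOn_const (by simp))] with ω hb hω
  ext t
  rw [hω, pinned_apply, hb, terminal, hb]
  simp only [state, intervalIntegral.integral_const, sub_zero, smul_eq_mul]
  field_simp
  ring

/-- The terminal value and the bridge are jointly Gaussian, with covariance `t - (t/T) T = 0`. -/
lemma indepFun_terminal_bridge [IsProbabilityMeasure μ] (hw : IsBrownianReal w μ) (hT : T ≠ 0) :
    IndepFun (w T) (bridge T w) μ := by
  have hT' : (T : ℝ) ≠ 0 := by exact_mod_cast hT
  set b : Set.Icc (0 : ℝ≥0) T → Ω → ℝ := fun t ω => w t ω + (-(t / T) : ℝ) * w T ω with hb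
  have hbm : ∀ t, AEMeasurable (b t) μ := fun t =>
    (hw.aemeasurable t).add ((hw.aemeasurable T).const_mul _)
  have hG : IsGaussianProcess (Sum.elim (fun _ : Unit => w T) b) μ := by
    refine hw.isGaussianProcess.of_isGaussianProcess ?_
    rintro (_ | t)
    · exact ⟨{T}, ContinuousLinearMap.proj ⟨T, by simp⟩, fun ω => rfl⟩
    · exact ⟨{(t : ℝ≥0), T}, ContinuousLinearMap.proj ⟨t, by simp⟩
        + (-(t / T) : ℝ) • ContinuousLinearMap.proj ⟨T, by simp⟩, fun ω => rfl⟩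
  have hind : IndepFun (fun ω (_ : Unit) => w T ω) (fun ω t => b t ω) μ := by
    refine hG.indepFun_of_covariance_eq_zero (fun _ => hw.aemeasurable T) hbm fun _ t => ?_
    have h2 := fun s => (hw.isGaussianProcess.hasGaussianLaw_eval s).memLp_two
    have hbt : b t = (w t) + (fun ω => (-(t / T) : ℝ) * w T ω) := rfl
    rw [hbt, covariance_add_right (h2 _) (h2 _) ((h2 _).const_mul _),
      covariance_const_mul_right, hw.covariance_eval, hw.covariance_eval,
      min_eq_right t.2.2, min_self]
    field_simp
    ring
  have hind' : IndepFun (w T) (fun ω t => bridge T w ω t) μ := by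
    refine (hind.comp (measurable_pi_apply ()) measurable_id).congr
      (Filter.EventuallyEq.rfl) ?_
    filter_upwards [bridge_ae_eq (T := T) hw] with ω hω
    ext t
    exact (hω t).symm
  -- Independence depends only on the generated σ-algebras, and those of the bridge as a path and as
  -- a family of coordinates coincide.
  rw [IndepFun_iff_Indep] at hind' ⊢
  rw [measurableSpace_pathSpace_eq_comap, MeasurableSpace.comap_comp]
  exact hind'

/-- Only the Gaussian factor depends on `a`, which reduces the change of measure to one dimension.
-/
lemma map_trajectory_const [IsProbabilityMeasure μ] (hw : IsBrownianReal w μ) (hT : T ≠ 0)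
    (a : ℝ) : μ.map (trajectory T w (fun _ => a)) =
      ((gaussianReal (a * T) T).prod (μ.map (bridge T w))).map pinned := by
  have hL := gaussianReal_const_add (hw.hasLaw_eval T) (a * T)
  rw [zero_add] at hL
  have hbr := aemeasurable_bridge (T := T) hw
  have hind : IndepFun (fun ω => a * T + w T ω) (bridge T w) μ :=
    (indepFun_terminal_bridge hw hT).comp (measurable_const_add (a * (T : ℝ))) measurable_id
  rw [Measure.map_congr (trajectory_const_ae_eq hw hT a), ← hL.map_eq,
    ← hind.map_prod_eq_prod_map_map hL.aemeasurable hbr,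
    AEMeasurable.map_map_of_aemeasurable measurable_pinned.aemeasurable
      (hL.aemeasurable.prodMk hbr)]
  rfl

/-- **Cameron–Martin formula** for a constant drift. -/
lemma map_trajectory_const_eq_withDensity [IsProbabilityMeasure μ] (hw : IsBrownianReal w μ)
    (hT : T ≠ 0) (a : ℝ) : μ.map (trajectory T w (fun _ => a)) =
      (μ.map (trajectory T w 0)).withDensity
        (fun x => ENNReal.ofReal (Real.exp (a * terminal x - a ^ 2 * T / 2))) := by
  have hT' : (T : ℝ) ≠ 0 := by exact_mod_cast hT
  have h0 := map_trajectory_const hw hT 0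
  have hz : (fun _ => 0 : ℝ → ℝ) = 0 := rfl
  rw [zero_mul, hz] at h0
  have hg : Measurable fun x : PathSpace T =>
      ENNReal.ofReal (Real.exp (a * terminal x - a ^ 2 * T / 2)) := by
    have := (continuous_terminal (T := T)).measurable
    fun_prop
  have : IsProbabilityMeasure (μ.map (bridge T w)) :=
    Measure.isProbabilityMeasure_map (aemeasurable_bridge hw)
  rw [map_trajectory_const hw hT, h0, gaussianReal_eq_withDensity _ hT,
    prod_withDensity_left (by fun_prop), ← map_withDensity_comp _ measurable_pinned hg]
  congr 2
  ext p
  simp only [Function.comp, terminal_pinned hT]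
  congr 2
  field_simp

/-! ### Optimality of the threshold test. -/

lemma falseAlarm_eq_map [IsProbabilityMeasure μ] (hw : IsBrownianReal w μ)
    {φ : PathSpace T → Fin 2} (hφ : IsTest φ) :
    falseAlarm μ w φ = (μ.map (trajectory T w 0)).real (φ ⁻¹' {1}) := by
  rw [measureReal_def, Measure.map_apply_of_aemeasurable
    (aemeasurable_trajectory (θ := 0) hw integrableOn_zero) (hφ (measurableSet_singleton 1))]
  rfl

lemma detectionFailure_eq_map [IsProbabilityMeasure μ] (hw : IsBrownianReal w μ)
    (hθ : IntegrableOn θ (Set.Icc 0 (T : ℝ))) {φ : PathSpace T → Fin 2} (hφ : IsTest φ) :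
    detectionFailure μ w θ φ = 1 - (μ.map (trajectory T w θ)).real (φ ⁻¹' {1}) := by
  have hm := aemeasurable_trajectory hw hθ
  have : IsProbabilityMeasure (μ.map (trajectory T w θ)) := Measure.isProbabilityMeasure_map hm
  rw [← probReal_compl_eq_one_sub (hφ (measurableSet_singleton 1)), measureReal_def,
    Measure.map_apply_of_aemeasurable hm (hφ (measurableSet_singleton 1)).compl]
  rw [detectionFailure, measureReal_def]
  congr 2
  ext ω
  simp only [Set.mem_ofPred_eq, Set.mem_preimage, Set.mem_compl_iff, Set.mem_singleton_iff]
  generalize φ (trajectory T w θ ω) = i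
  fin_cases i <;> simp

/-- Against a positive constant drift, the terminal threshold test is the essentially unique most
powerful test of its level. -/
lemma thresholdTest_optimal_of_const [IsProbabilityMeasure μ] (hw : IsBrownianReal w μ)
    (hT : 0 < T) {a ε : ℝ} (ha : 0 < a) (hε0 : 0 < ε) (hε1 : ε < 1) {φ : PathSpace T → Fin 2}
    (hφ : φ ∈ tests μ T w ε) :
    detectionFailure μ w (fun _ => a) (thresholdTest T ε) ≤ detectionFailure μ w (fun _ => a) φ ∧
    (detectionFailure μ w (fun _ => a) φ ≤ detectionFailure μ w (fun _ => a) (thresholdTest T ε) →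
      (∀ᵐ ω ∂μ, φ (trajectory T w (fun _ => a) ω) =
        thresholdTest T ε (trajectory T w (fun _ => a) ω)) ∧
      ∀ᵐ ω ∂μ, φ (trajectory T w 0 ω) = thresholdTest T ε (trajectory T w 0 ω)) := by
  have hia : IntegrableOn (fun _ : ℝ => a) (Set.Icc 0 (T : ℝ)) := integrableOn_const (by simp)
  have hm0 := aemeasurable_trajectory (T := T) (θ := 0) hw integrableOn_zero
  have hma := aemeasurable_trajectory (T := T) hw hia
  have hφs := (thresholdTest_mem_tests hw hT hε0 hε1).1
  have hL := hasLaw_terminal_trajectory (T := T) (θ := 0) hw integrableOn_zero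
  simp only [Pi.zero_apply, intervalIntegral.integral_zero] at hL
  -- The level is exhausted exactly, so every admissible test has at most this size.
  have hα : falseAlarm μ w (thresholdTest T ε) = ε := by
    rw [thresholdTest_eq_statisticTest, falseAlarm_statisticTest hT.ne' hL,
      stdNormalCDF_stdNormalInv (by linarith) (by linarith)]
    ring
  have hν : IsProbabilityMeasure (μ.map (trajectory T w 0)) := Measure.isProbabilityMeasure_map hm0
  have hνa : IsProbabilityMeasure (μ.map (trajectory T w fun _ => a)) :=
    Measure.isProbabilityMeasure_map hma
  have hd := map_trajectory_const_eq_withDensity hw hT.ne' a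
  rw [detectionFailure_eq_map hw hia hφs, detectionFailure_eq_map hw hia hφ.1]
  set k := √(T : ℝ) * stdNormalInv (1 - ε) with hk
  set g : PathSpace T → ℝ := fun x => Real.exp (a * terminal x - a ^ 2 * T / 2) with hg
  have hgm : Measurable g := by
    have := (continuous_terminal (T := T)).measurable
    fun_prop
  have hgi : Integrable g (μ.map (trajectory T w 0)) := by
    refine ⟨hgm.aestronglyMeasurable, ?_⟩
    rw [hasFiniteIntegral_iff_ofReal (Filter.Eventually.of_forall fun x => (Real.exp_pos _).le),
      ← setLIntegral_univ, ← withDensity_apply _ MeasurableSet.univ, ← hd]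
    exact measure_lt_top _ _
  have hA : ∀ x, x ∈ thresholdTest T ε ⁻¹' {1} ↔ Real.exp (a * k - a ^ 2 * T / 2) < g x := by
    intro x
    simp [thresholdTest, hg, ← hk, ha]
  have hsize : (μ.map (trajectory T w 0)).real (φ ⁻¹' {1}) ≤
      (μ.map (trajectory T w 0)).real (thresholdTest T ε ⁻¹' {1}) := by
    rw [← falseAlarm_eq_map hw hφ.1, ← falseAlarm_eq_map hw hφs, hα]
    exact hφ.2
  obtain ⟨h1, h2⟩ := neyman_pearson (fun x => (Real.exp_pos _).le) hgi (Real.exp_pos _).le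
    (hφs (measurableSet_singleton 1)) (hφ.1 (measurableSet_singleton 1)) hA hsize
  rw [← hd] at h1 h2
  refine ⟨by linarith, fun hle => ?_⟩
  -- A tie means `x(T) = k`, which is null since the law of `x(T)` has no atoms.
  have hne : ∀ᵐ x ∂(μ.map (trajectory T w 0)), g x ≠ Real.exp (a * k - a ^ 2 * T / 2) := by
    refine (ae_map_iff hm0 (measurableSet_eq_fun hgm measurable_const).compl).2 ?_
    have : NullSingletonClass (gaussianReal 0 T) := nullSingletonClass_gaussianReal hT.ne'
    have hae : ∀ᵐ y ∂(gaussianReal 0 T), y ≠ k := by simp [ae_iff, measure_singleton]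
    rw [← hL.map_eq] at hae
    filter_upwards [ae_of_ae_map hL.aemeasurable hae] with ω hω
    simpa [hg, ha.ne'] using hω
  have hae := h2 (by linarith) hne
  have hae' : ∀ᵐ x ∂(μ.map (trajectory T w 0)), φ x = thresholdTest T ε x := by
    filter_upwards [hae] with x hx
    simp only [Set.mem_preimage, Set.mem_singleton_iff] at hx
    revert hx
    generalize φ x = i, thresholdTest T ε x = j
    fin_cases i <;> fin_cases j <;> simp
  have hac : μ.map (trajectory T w fun _ => a) ≪ μ.map (trajectory T w 0) := by
    rw [hd]
    exact withDensity_absolutelyContinuous _ _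
  exact ⟨ae_of_ae_map hma (hac.ae_le hae'), ae_of_ae_map hm0 hae'⟩

/-! ### The saddle point, its uniqueness and the value. -/

lemma stdNormalInv_pos {p : ℝ} (hp : 1 / 2 < p) (hp1 : p < 1) : 0 < stdNormalInv p := by
  have h := stdNormalCDF_neg 0
  rw [neg_zero] at h
  rw [← strictMono_stdNormalCDF.lt_iff_lt, stdNormalCDF_stdNormalInv (by linarith) hp1]
  linarith

lemma integral_biasAttack (T : ℝ≥0) (d c : ℝ) :
    ∫ s in (0 : ℝ)..T, biasAttack T d c s = T * (stdNormalInv c / √(T : ℝ) + d) := by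
  simp only [biasAttack, intervalIntegral.integral_const, sub_zero, smul_eq_mul]

lemma biasAttack_mem_attacks [IsProbabilityMeasure μ] (hw : IsBrownianReal w μ) (hT : 0 < T)
    {d c : ℝ} (hc0 : 0 < c) (hc1 : c < 1) : biasAttack T d c ∈ attacks μ T w d c := by
  refine ⟨⟨measurable_const, integrableOn_const (by simp)⟩, ?_⟩
  rw [le_successRate_iff hw hT hc0 hc1]
  exact (integral_biasAttack T d c).ge

lemma detectionFailure_mem_Icc [IsProbabilityMeasure μ] (φ : PathSpace T → Fin 2) :
    detectionFailure μ w θ φ ∈ Set.Icc 0 1 := ⟨measureReal_nonneg, measureReal_le_one⟩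

lemma isSaddlePoint_biasAttack_thresholdTest [IsProbabilityMeasure μ] (hw : IsBrownianReal w μ)
    (hT : 0 < T) {d c ε : ℝ} (hd : 0 < d) (hc : 1 / 2 < c) (hc1 : c < 1)
    (hε0 : 0 < ε) (hε1 : ε < 1) :
    IsSaddlePoint μ T w d c ε (biasAttack T d c) (thresholdTest T ε) := by
  have hc0 : 0 < c := by linarith
  have hpos := stdNormalInv_pos hc hc1
  have ha : 0 < stdNormalInv c / √(T : ℝ) + d := by positivity
  have hatt := biasAttack_mem_attacks (d := d) hw hT hc0 hc1
  refine ⟨hatt, thresholdTest_mem_tests hw hT hε0 hε1, fun θ hθ => ?_, fun φ hφ =>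
    (thresholdTest_optimal_of_const hw hT ha hε0 hε1 hφ).1⟩
  have hle := (le_successRate_iff hw hT hc0 hc1).1 hθ.2
  rw [detectionFailure_thresholdTest hw hT hθ.1.integrableOn,
    detectionFailure_thresholdTest hw hT hatt.1.integrableOn, strictMono_stdNormalCDF.le_iff_le]
  gcongr
  rwa [integral_biasAttack]

lemma IsSaddlePoint.isLeast_worstCase [IsProbabilityMeasure μ] {d c ε : ℝ}
    {φ : PathSpace T → Fin 2} (h : IsSaddlePoint μ T w d c ε θ φ) :
    IsLeast (worstCase μ T w d c '' tests μ T w ε) (detectionFailure μ w θ φ) := by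
  refine ⟨⟨φ, h.2.1, IsGreatest.csSup_eq ⟨⟨θ, h.1, rfl⟩, ?_⟩⟩, ?_⟩
  · rintro _ ⟨θ', hθ', rfl⟩
    exact h.2.2.1 θ' hθ'
  · rintro _ ⟨φ', hφ', rfl⟩
    refine (h.2.2.2 φ' hφ').trans (le_csSup ⟨1, ?_⟩ ⟨θ, h.1, rfl⟩)
    rintro _ ⟨θ', -, rfl⟩
    exact (detectionFailure_mem_Icc φ').2

lemma IsSaddlePoint.isGreatest_bestResponse [IsProbabilityMeasure μ] {d c ε : ℝ}
    {φ : PathSpace T → Fin 2} (h : IsSaddlePoint μ T w d c ε θ φ) :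
    IsGreatest (bestResponse μ T w ε '' attacks μ T w d c) (detectionFailure μ w θ φ) := by
  refine ⟨⟨θ, h.1, IsLeast.csInf_eq ⟨⟨φ, h.2.1, rfl⟩, ?_⟩⟩, ?_⟩
  · rintro _ ⟨φ', hφ', rfl⟩
    exact h.2.2.2 φ' hφ'
  · rintro _ ⟨θ', hθ', rfl⟩
    refine le_trans (csInf_le ⟨0, ?_⟩ ⟨φ, h.2.1, rfl⟩) (h.2.2.1 θ' hθ')
    rintro _ ⟨φ', -, rfl⟩
    exact (detectionFailure_mem_Icc φ').1

/-- Saddle points of a zero-sum game are interchangeable. -/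
lemma IsSaddlePoint.interchange {d c ε : ℝ} {θ' : ℝ → ℝ} {φ φ' : PathSpace T → Fin 2}
    (h : IsSaddlePoint μ T w d c ε θ φ) (h' : IsSaddlePoint μ T w d c ε θ' φ') :
    IsSaddlePoint μ T w d c ε θ φ' ∧
      detectionFailure μ w θ φ' = detectionFailure μ w θ φ := by
  have h1 := h'.2.2.1 θ h.1
  have h2 := h'.2.2.2 φ h.2.1
  have h3 := h.2.2.1 θ' h'.1
  have h4 := h.2.2.2 φ' h'.2.1
  exact ⟨⟨h.1, h'.2.1, fun η hη => (h'.2.2.1 η hη).trans (by linarith),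
    fun ψ hψ => le_trans (by linarith) (h.2.2.2 ψ hψ)⟩, by linarith⟩

/-- By interchange, `(θ*, φ)` and `(θ, φ*)` are both saddle points with the same value. The first
puts `φ` in the equality case of Neyman–Pearson; the second fixes the total drift of `θ` and makes
`φ*` optimal against it. -/
lemma IsSaddlePoint.eq_biasAttack_thresholdTest [IsProbabilityMeasure μ]
    (hw : IsBrownianReal w μ) (hT : 0 < T) {d c ε : ℝ} (hd : 0 < d) (hc : 1 / 2 < c)
    (hc1 : c < 1) (hε0 : 0 < ε) (hε1 : ε < 1) {φ : PathSpace T → Fin 2}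
    (h : IsSaddlePoint μ T w d c ε θ φ) :
    (∀ᵐ t ∂(volume.restrict (Set.Icc 0 (T : ℝ))), θ t = biasAttack T d c t) ∧
    (∀ᵐ ω ∂μ, φ (trajectory T w (biasAttack T d c) ω) =
      thresholdTest T ε (trajectory T w (biasAttack T d c) ω)) ∧
    ∀ᵐ ω ∂μ, φ (trajectory T w 0 ω) = thresholdTest T ε (trajectory T w 0 ω) := by
  have hs := isSaddlePoint_biasAttack_thresholdTest hw hT hd hc hc1 hε0 hε1
  have hpos := stdNormalInv_pos hc hc1
  have hT' : (0 : ℝ) < T := hT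
  have ha : 0 < stdNormalInv c / √(T : ℝ) + d := by positivity
  refine ⟨?_, (thresholdTest_optimal_of_const hw hT ha hε0 hε1 h.2.1).2
    (hs.interchange h).2.le⟩
  obtain ⟨hθs, -⟩ := h.interchange hs
  have hβ := (hs.2.2.1 θ h.1).antisymm (hθs.2.2.1 _ hs.1)
  have hi := h.1.1.integrableOn
  rw [detectionFailure_thresholdTest hw hT hi,
    detectionFailure_thresholdTest hw hT hs.1.1.integrableOn,
    strictMono_stdNormalCDF.injective.eq_iff, sub_right_inj,
    div_left_inj' (Real.sqrt_pos.2 hT').ne'] at hβ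
  rw [integral_biasAttack] at hβ
  refine ae_eq_const_of_integral_eq (a := stdNormalInv c / √(T : ℝ) + d) hi fun t => ?_
  rw [integral_eq_of_thresholdTest_optimal hw hT hi hε0 hε1 (by rw [hβ]; positivity) hθs.2.2.2, hβ]
  rw [← mul_assoc, div_mul_cancel₀ _ hT'.ne', mul_comm]

lemma detectionFailure_biasAttack_thresholdTest [IsProbabilityMeasure μ]
    (hw : IsBrownianReal w μ) (hT : 0 < T) (d c ε : ℝ) :
    detectionFailure μ w (biasAttack T d c) (thresholdTest T ε) =
      stdNormalCDF (stdNormalInv (1 - ε) - stdNormalInv c - √(T : ℝ) * d) := by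
  have hs : 0 < √(T : ℝ) := Real.sqrt_pos.2 hT
  rw [detectionFailure_thresholdTest (θ := biasAttack T d c) hw hT (integrableOn_const (by simp)),
    integral_biasAttack]
  congr 1
  have hdiv : (T : ℝ) / √(T : ℝ) = √(T : ℝ) := Real.div_sqrt
  rw [mul_div_right_comm, hdiv, mul_add, mul_div_cancel₀ _ hs.ne']
  ring

end

end AttackGame

theorem theorem1 {Ω : Type*} [MeasurableSpace Ω] (μ : Measure Ω) [IsProbabilityMeasure μ]
    (w : ℝ≥0 → Ω → ℝ) (hw : IsBrownianReal w μ)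
    (T : ℝ≥0) (hT : 0 < T) (d c ε : ℝ) (hd : 0 < d) (hc : 1 / 2 < c) (hc1 : c < 1)
    (hε : 0 < ε) (hε1 : ε < 1 / 2) :
    -- the pair `(θ*, φ*)` is a saddle point
    AttackGame.IsSaddlePoint μ T w d c ε
      (AttackGame.biasAttack T d c) (AttackGame.thresholdTest T ε) ∧
    -- the min-max and the max-min are attained, at `φ*` and `θ*`, and equal `β(θ*, φ*)`
    IsLeast (AttackGame.worstCase μ T w d c '' AttackGame.tests μ T w ε)
      (AttackGame.detectionFailure μ w
        (AttackGame.biasAttack T d c) (AttackGame.thresholdTest T ε)) ∧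
    IsGreatest (AttackGame.bestResponse μ T w ε '' AttackGame.attacks μ T w d c)
      (AttackGame.detectionFailure μ w
        (AttackGame.biasAttack T d c) (AttackGame.thresholdTest T ε)) ∧
    -- uniqueness: `θ' = θ*` a.e. on `[0,T]`, and `φ'(x) = φ*(x)` `μ`-almost surely, both for the
    -- trajectory under attack and for the trajectory without attack
    (∀ (θ' : ℝ → ℝ) (φ' : AttackGame.PathSpace T → Fin 2),
      AttackGame.IsSaddlePoint μ T w d c ε θ' φ' →
        (∀ᵐ t ∂(volume.restrict (Set.Icc 0 (T : ℝ))), θ' t = AttackGame.biasAttack T d c t) ∧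
        (∀ᵐ ω ∂μ,
          φ' (AttackGame.trajectory T w (AttackGame.biasAttack T d c) ω) =
            AttackGame.thresholdTest T ε
              (AttackGame.trajectory T w (AttackGame.biasAttack T d c) ω)) ∧
        (∀ᵐ ω ∂μ,
          φ' (AttackGame.trajectory T w 0 ω) =
            AttackGame.thresholdTest T ε (AttackGame.trajectory T w 0 ω))) ∧
    -- the value of the game
    AttackGame.detectionFailure μ w (AttackGame.biasAttack T d c) (AttackGame.thresholdTest T ε) =
      AttackGame.stdNormalCDF (AttackGame.stdNormalInv (1 - ε) - AttackGame.stdNormalInv c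
        - √(T : ℝ) * d) ∧
    (1 - ε = c →
      AttackGame.detectionFailure μ w
          (AttackGame.biasAttack T d c) (AttackGame.thresholdTest T ε) =
        AttackGame.stdNormalCDF (-(√(T : ℝ) * d))) := by
  have hε2 : ε < 1 := by linarith
  have hs := AttackGame.isSaddlePoint_biasAttack_thresholdTest hw hT hd hc hc1 hε hε2
  have hval := AttackGame.detectionFailure_biasAttack_thresholdTest hw hT d c ε
  refine ⟨hs, hs.isLeast_worstCase, hs.isGreatest_bestResponse,
    fun θ' φ' h => h.eq_biasAttack_thresholdTest hw hT hd hc hc1 hε hε2, hval, fun hce => ?_⟩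
  rw [hval, hce]
  congr 1
  ring
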